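/- Let $\mathcal F$ be a filter on $\omega$, i.e. a family of infinite subsets of $\omega$ that contains all cofinite sets and is closed under finite intersections and under supersets. Mathias forcing $\mathbb M_{\mathcal F}$ consists of the pairs $\langle s,F\rangle$ with $s\subset\omega$ finite, $F\in\mathcal F$, and every element of $s$ smaller than every element of $F$; a condition $\langle s,F\rangle$ is stronger than $\langle t,G\rangle$ if $F\subset G$, $s$ is an end-extension of $t$, and $s\setminus t\subset G$. Then $\mathbb M_{\mathcal F}$ adds no dominating reals (that is, no condition forces that there is $x\in\omega^\omega$ in the generic extension such that for every ground model $a\in\omega^\omega$ one has $a(n)\le x(n)$ for all but finitely many $n$) if and only if $\mathcal F$, as a subspace of $\mathcal P(\omega)\cong 2^\omega$, has the Menger covering property: for every sequence $\langle\mathcal U_n:n\in\omega\rangle$ of open covers of $\mathcal F$ there are finite $\mathcal V_n\subset\mathcal U_n$ such that $\bigcup_{n\in\omega}\bigcup\mathcal V_n=\mathcal F$. -/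

import Mathlib

/-- The Menger covering property of a topological space: from any sequence of open covers one can
choose finite subfamilies whose unions cover the space. -/
def MengerProperty (X : Type*) [TopologicalSpace X] : Prop :=
  ∀ U : ℕ → Set (Set X),
    (∀ n, (∀ u ∈ U n, IsOpen u) ∧ ⋃₀ U n = Set.univ) →
    ∃ V : ℕ → Set (Set X),
      (∀ n, V n ⊆ U n ∧ (V n).Finite) ∧ ⋃ n, ⋃₀ V n = Set.univ

/-- A filter on `ℕ` viewed as a subset of the Cantor space `ℕ → Bool` (discrete `Bool`, product
topology), via characteristic functions. -/
def filterCantor (F : Filter ℕ) : Set (ℕ → Bool) :=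
  {x | {n | x n = true} ∈ F}

/-- Conditions of the Mathias forcing associated with `F`: pairs of a finite `stem` and a set `side`
in `F` with every element of the stem below every element of `side`. -/
@[ext]
structure MathiasForcing (F : Filter ℕ) where
  stem : Finset ℕ
  side : Set ℕ
  side_mem : side ∈ F
  stem_lt_side : ∀ i ∈ stem, ∀ j ∈ side, i < j

/-- `p ≤ q` means that `p` is stronger than `q`: the side set shrinks, the stem of `p` end-extends
that of `q`, and the new elements of the stem belong to the side set of `q`. -/
instance (F : Filter ℕ) : LE (MathiasForcing F) where
  le p q := p.side ⊆ q.side ∧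
    (q.stem ⊆ p.stem ∧ ∀ i ∈ p.stem, i ∉ q.stem → ∀ j ∈ q.stem, j < i) ∧
    ∀ i ∈ p.stem, i ∉ q.stem → i ∈ q.side

instance (F : Filter ℕ) : PartialOrder (MathiasForcing F) where
  le_refl p := ⟨subset_rfl, ⟨subset_rfl, fun _ hi hi' => absurd hi hi'⟩,
    fun _ hi hi' => absurd hi hi'⟩
  le_trans p q r hpq hqr := by
    obtain ⟨h1, ⟨h2, h3⟩, h4⟩ := hpq
    obtain ⟨k1, ⟨k2, k3⟩, k4⟩ := hqr
    refine ⟨h1.trans k1, ⟨k2.trans h2, fun i hi hir j hj => ?_⟩, fun i hi hir => ?_⟩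
    · by_cases hq : i ∈ q.stem
      · exact k3 i hq hir j hj
      · exact h3 i hi hq j (k2 hj)
    · by_cases hq : i ∈ q.stem
      · exact k4 i hq hir
      · exact k1 (h4 i hi hq)
  le_antisymm p q hpq hqp :=
    MathiasForcing.ext (hqp.2.1.1.antisymm hpq.2.1.1) (hpq.1.antisymm hqp.1)

/-- A (nice) `P`-name for a subset of `ℕ × ℕ`: a set of triples `(n, m, s)`, where `s : P` puts the
pair `(n, m)` into the relation. For a generic filter `G`, the name is evaluated as
`{(n, m) | ∃ s ∈ G, (n, m, s) ∈ τ}`. Every subset of `ℕ × ℕ` in a generic extension by `P` is the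
evaluation of such a name. -/
abbrev RelName (P : Type*) := Set (ℕ × ℕ × P)

namespace RelName

variable {P : Type*} [Preorder P]

/-- `p ⊩ (n, m) ∈ τ`: the conditions lying below some `s` with `(n, m, s) ∈ τ` are dense
below `p`. -/
def Forces (p : P) (τ : RelName P) (n m : ℕ) : Prop :=
  ∀ q ≤ p, ∃ r ≤ q, ∃ s, r ≤ s ∧ (n, m, s) ∈ τ

/-- `p ⊩ τ` is (the graph of) a function from `ℕ` to `ℕ`. -/
def ForcesReal (p : P) (τ : RelName P) : Prop :=
  (∀ n, ∀ q ≤ p, ∃ r ≤ q, ∃ m, Forces r τ n m) ∧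
  (∀ n m m', ∀ q ≤ p, Forces q τ n m → Forces q τ n m' → m = m')

/-- For `τ` a name of a function and `a` in the ground model:
`p ⊩ a n ≤ τ n` for all but finitely many `n`. -/
def ForcesEventuallyGe (p : P) (τ : RelName P) (a : ℕ → ℕ) : Prop :=
  ∀ q ≤ p, ∃ r ≤ q, ∃ k, ∀ n ≥ k, ∀ s ≤ r, ∀ m, Forces s τ n m → a n ≤ m

/-- `p ⊩ τ` is a dominating real over the ground model. -/
def ForcesDominating (p : P) (τ : RelName P) : Prop :=
  ForcesReal p τ ∧ ∀ a : ℕ → ℕ, ForcesEventuallyGe p τ a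

end RelName

/-- The forcing notion `P` adds no dominating reals: no condition forces any name to be a dominating
real over the ground model; that is, no generic extension by `P` contains a dominating real. -/
def AddsNoDominatingReal (P : Type*) [Preorder P] : Prop :=
  ∀ (p : P) (τ : RelName P), ¬ RelName.ForcesDominating p τ

/-!
Both properties are equivalent to a combinatorial one about families of finite sets. Call a family
of finite sets positive if every member of `F` includes one of its elements; the combinatorial
property says that from any sequence of positive families one can choose finite subfamilies whose
union is positive.

For `A ∈ F` the set of all supersets of `A` is compact and contained in `F`, so finitely many
members of an open cover already cover all supersets of some finite `s ⊆ A`. Hence open covers of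
`F` can be replaced by positive families.

If the combinatorial property holds and `τ` names a real, then for the stem `s` of any condition
and each `n` the sets `u` such that some condition with stem `s ∪ u` decides `τ n` form a positive
family. Choosing finite subfamilies yields, for each of the countably many stems, a ground model
function `g` such that `τ n < g n` remains possible for arbitrarily large `n`; a function eventually
above all these `g` is not dominated by `τ`.

If the property fails for `X 0, X 1, …`, then sending `n` to the least `k` such that the generic set
includes a member of `X n` lying in `[n, k)` defines a dominating real: given `a`, some `A ∈ F`
includes no member of any `X n` contained in `[0, a n)`, and the generic set is forced to be almost
contained in `A` by a condition with side set inside `A`.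
-/

open Set Filter Topology

lemma exists_finset_pi_subset_of_isOpen {ι : Type*} {X : ι → Type*}
    [∀ i, TopologicalSpace (X i)] [∀ i, CompactSpace (X i)] {t : ∀ i, Set (X i)}
    (ht : ∀ i, IsClosed (t i)) {A : Set ι} {O : Set (∀ i, X i)} (hO : IsOpen O) (hAO : A.pi t ⊆ O) :
    ∃ s : Finset ι, (s : Set ι) ⊆ A ∧ (s : Set ι).pi t ⊆ O := by
  classical
  have hclosed (s : Finset ι) : IsClosed ((A ∩ s).pi t) := isClosed_set_pi fun i _ => ht i
  have hanti : Antitone fun s : Finset ι => (A ∩ s).pi t := fun s s' hss' =>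
    pi_mono' (fun _ _ => subset_rfl) (inter_subset_inter_right A (Finset.coe_subset.2 hss'))
  have hinter : ⋂ s : Finset ι, (A ∩ s).pi t ⊆ A.pi t := fun x hx i hi =>
    mem_iInter.1 hx {i} i ⟨hi, by simp⟩
  obtain ⟨s, hs⟩ := exists_subset_nhds_of_isCompact' hanti.directed_ge
    (fun s => (hclosed s).isCompact) hclosed fun x hx => hO.mem_nhds (hAO (hinter hx))
  have hfin : (A ∩ s).Finite := s.finite_toSet.inter_of_right A
  exact ⟨hfin.toFinset, by simp, by simpa using hs⟩

lemma exists_forall_eventuallyLE {ι β : Type*} [Countable ι] [Nonempty ι] [SemilatticeSup β]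
    (g : ι → ℕ → β) : ∃ a : ℕ → β, ∀ i, g i ≤ᶠ[atTop] a := by
  obtain ⟨e, he⟩ := exists_surjective_nat ι
  refine ⟨fun n => partialSups (g ∘ e) n n, he.forall.2 fun j => ?_⟩
  filter_upwards [eventually_ge_atTop j] with n hn
  exact le_partialSups_of_le (g ∘ e) hn n

/-- The family `X` of finite sets is `F`-positive: every member of `F` includes a member of `X`.
Such families correspond to covers of `F`, viewed as a subset of the Cantor space, by the open sets
of all supersets of `s`, for `s ∈ X`. -/
def IsFinsetPositive {α : Type*} (F : Filter α) (X : Set (Finset α)) : Prop :=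
  ∀ A ∈ F, ∃ s ∈ X, (s : Set α) ⊆ A

/-- The combinatorial form of the Menger property of a filter: positive families of finite sets
take the place of open covers. -/
def FinsetMenger {α : Type*} (F : Filter α) : Prop :=
  ∀ X : ℕ → Set (Finset α), (∀ n, IsFinsetPositive F (X n)) →
    ∃ Y : ℕ → Set (Finset α), (∀ n, Y n ⊆ X n ∧ (Y n).Finite) ∧ IsFinsetPositive F (⋃ n, Y n)

section FinsetMenger

variable {α : Type*} {F : Filter α}

lemma IsFinsetPositive.mono {X Y : Set (Finset α)} (hX : IsFinsetPositive F X) (hXY : X ⊆ Y) :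
    IsFinsetPositive F Y := fun A hA =>
  let ⟨s, hs, hsA⟩ := hX A hA
  ⟨s, hXY hs, hsA⟩

lemma FinsetMenger.exists_finite_tails_positive (h : FinsetMenger F) {X : ℕ → Set (Finset α)}
    (hX : ∀ n, IsFinsetPositive F (X n)) :
    ∃ Y : ℕ → Set (Finset α), (∀ n, Y n ⊆ X n ∧ (Y n).Finite) ∧
      ∀ k, IsFinsetPositive F (⋃ n ≥ k, Y n) := by
  choose Z hZ hpos using fun k => h (fun n => X (k + n)) fun n => hX (k + n)
  refine ⟨fun n => ⋃ k ∈ Iic n, Z k (n - k), fun n => ⟨iUnion₂_subset fun k hk => ?_, ?_⟩,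
    fun k => (hpos k).mono (iUnion_subset fun n s hs => ?_)⟩
  · simpa only [Nat.add_sub_cancel' (mem_Iic.1 hk)] using (hZ k (n - k)).1
  · exact (finite_Iic n).biUnion fun k _ => (hZ k (n - k)).2
  · exact mem_iUnion₂.2 ⟨k + n, Nat.le_add_right k n,
      mem_iUnion₂.2 ⟨k, Nat.le_add_right k n, by rwa [Nat.add_sub_cancel_left]⟩⟩

lemma FinsetMenger.exists_bound (h : FinsetMenger F) {φ : ℕ → Finset α → ℕ → Prop}
    (hφ : ∀ n, IsFinsetPositive F {u | ∃ m, φ n u m}) :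
    ∃ g : ℕ → ℕ, ∀ k, IsFinsetPositive F {u | ∃ n ≥ k, ∃ m < g n, φ n u m} := by
  obtain ⟨Y, hY, hpos⟩ := h.exists_finite_tails_positive hφ
  have hbound (n : ℕ) : ∀ᶠ b in atTop, ∀ u ∈ Y n, ∃ m < b, φ n u m := by
    refine (eventually_all_finite (hY n).2).2 fun u hu => ?_
    obtain ⟨m, hm⟩ := (hY n).1 hu
    exact (eventually_gt_atTop m).mono fun b hb => ⟨m, hb, hm⟩
  choose g hg using fun n => (hbound n).exists
  exact ⟨g, fun k => (hpos k).mono (iUnion₂_subset fun n hn u hu => ⟨n, hn, hg n u hu⟩)⟩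

end FinsetMenger

/-- The points of the Cantor space that are characteristic functions of supersets of `A`. -/
def cantorCone {ι : Type*} (A : Set ι) : Set (ι → Bool) := A.pi fun _ => {true}

section Cantor

lemma isClosed_cantorCone {ι : Type*} (A : Set ι) : IsClosed (cantorCone A) :=
  isClosed_set_pi fun _ _ => isClosed_singleton

lemma isOpen_cantorCone {ι : Type*} {A : Set ι} (hA : A.Finite) : IsOpen (cantorCone A) :=
  isOpen_set_pi hA fun _ _ => isOpen_discrete _

variable {F : Filter ℕ}

lemma cantorCone_subset_filterCantor {A : Set ℕ} (hA : A ∈ F) : cantorCone A ⊆ filterCantor F :=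
  fun _ hx => mem_of_superset hA hx

lemma isCompact_preimage_cantorCone {A : Set ℕ} (hA : A ∈ F) :
    IsCompact (((↑) : filterCantor F → ℕ → Bool) ⁻¹' cantorCone A) :=
  (IsInducing.subtypeVal.isCompact_preimage_iff <| by
    simpa using cantorCone_subset_filterCantor hA).2 (isClosed_cantorCone A).isCompact

lemma exists_finset_preimage_cantorCone_subset_sUnion {U : Set (Set (filterCantor F))}
    (hU : ∀ u ∈ U, IsOpen u) (hcov : ⋃₀ U = univ) {A : Set ℕ} (hA : A ∈ F) :
    ∃ s : Finset ℕ, (s : Set ℕ) ⊆ A ∧ ∃ V ⊆ U, V.Finite ∧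
      ((↑) : filterCantor F → ℕ → Bool) ⁻¹' cantorCone s ⊆ ⋃₀ V := by
  obtain ⟨V, hVU, hVfin, hAV⟩ := (isCompact_preimage_cantorCone hA).elim_finite_subcover_image
    (c := id) hU (by simp [← sUnion_eq_biUnion, hcov])
  simp only [id, ← sUnion_eq_biUnion] at hAV
  obtain ⟨O, hO, hOV⟩ := isOpen_induced_iff.1 (isOpen_sUnion fun u hu => hU u (hVU hu))
  have hAO : cantorCone A ⊆ O := fun x hx =>
    (hOV.symm ▸ hAV) (a := ⟨x, cantorCone_subset_filterCantor hA hx⟩) hx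
  obtain ⟨s, hsA, hsO⟩ := exists_finset_pi_subset_of_isOpen (fun _ => isClosed_singleton) hO hAO
  exact ⟨s, hsA, V, hVU, hVfin, hOV ▸ preimage_mono hsO⟩

lemma finsetMenger_of_mengerProperty (h : MengerProperty (filterCantor F)) : FinsetMenger F := by
  classical
  intro X hX
  let cone (s : Finset ℕ) : Set (filterCantor F) := (↑) ⁻¹' cantorCone (s : Set ℕ)
  have hcone (n : ℕ) : (∀ u ∈ cone '' X n, IsOpen u) ∧ ⋃₀ (cone '' X n) = univ := by
    refine ⟨forall_mem_image.2 fun s _ =>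
      (isOpen_cantorCone s.finite_toSet).preimage continuous_subtype_val,
      eq_univ_of_forall fun x => ?_⟩
    obtain ⟨s, hs, hsx⟩ := hX n _ x.2
    exact ⟨cone s, mem_image_of_mem cone hs, hsx⟩
  obtain ⟨V, hV, hcov⟩ := h (fun n => cone '' X n) hcone
  choose Y hYX hYfin hYV using fun n =>
    exists_subset_image_finite_and.1 ⟨V n, (hV n).1, (hV n).2, rfl⟩
  refine ⟨Y, fun n => ⟨hYX n, hYfin n⟩, fun A hA => ?_⟩
  let x : filterCantor F := ⟨fun i => decide (i ∈ A), by simpa [filterCantor] using hA⟩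
  obtain ⟨n, u, hu, hxu⟩ := mem_iUnion.1 (hcov.ge (mem_univ x))
  rw [hYV n] at hu
  obtain ⟨s, hs, rfl⟩ := hu
  exact ⟨s, mem_iUnion.2 ⟨n, hs⟩, fun i hi => by simpa [x] using hxu i hi⟩

lemma mengerProperty_of_finsetMenger (h : FinsetMenger F) : MengerProperty (filterCantor F) := by
  intro U hU
  let X (n : ℕ) : Set (Finset ℕ) :=
    {s | ∃ V ⊆ U n, V.Finite ∧ ((↑) : filterCantor F → ℕ → Bool) ⁻¹' cantorCone s ⊆ ⋃₀ V}
  have hX (n : ℕ) : IsFinsetPositive F (X n) := fun A hA =>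
    let ⟨s, hsA, hs⟩ := exists_finset_preimage_cantorCone_subset_sUnion (hU n).1 (hU n).2 hA
    ⟨s, hs, hsA⟩
  obtain ⟨Y, hY, hpos⟩ := h X hX
  choose V hVU hVfin hV using fun n (s : Y n) => (hY n).1 s.2
  refine ⟨fun n => ⋃ s : Y n, V n s, fun n => ⟨iUnion_subset (hVU n), ?_⟩,
    eq_univ_of_forall fun x => ?_⟩
  · have := (hY n).2.to_subtype
    exact finite_iUnion (hVfin n)
  · obtain ⟨s, hs, hsx⟩ := hpos _ x.2
    obtain ⟨n, hsn⟩ := mem_iUnion.1 hs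
    obtain ⟨u, hu, hxu⟩ := hV n ⟨s, hsn⟩ hsx
    exact mem_iUnion.2 ⟨n, u, mem_iUnion.2 ⟨⟨s, hsn⟩, hu⟩, hxu⟩

theorem mengerProperty_filterCantor_iff : MengerProperty (filterCantor F) ↔ FinsetMenger F :=
  ⟨finsetMenger_of_mengerProperty, mengerProperty_of_finsetMenger⟩

end Cantor

namespace RelName

variable {P : Type*} [Preorder P] {p q : P} {τ : RelName P}

lemma Forces.mono {n m : ℕ} (h : Forces p τ n m) (hqp : q ≤ p) : Forces q τ n m :=
  fun r hr => h r (hr.trans hqp)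

lemma ForcesReal.mono (h : ForcesReal p τ) (hqp : q ≤ p) : ForcesReal q τ :=
  ⟨fun n r hr => h.1 n r (hr.trans hqp), fun n m m' r hr => h.2 n m m' r (hr.trans hqp)⟩

end RelName

/-- The times `k` by which `t`, looked at from `n` on, has included a member of `X`. -/
def hittingTimes (X : Set (Finset ℕ)) (n : ℕ) (t : Finset ℕ) : Set ℕ :=
  {k | ∃ s ∈ X, s ⊆ t ∩ Finset.Ico n k}

section HittingTimes

variable {X : Set (Finset ℕ)} {n k : ℕ} {s t t' : Finset ℕ}

lemma hittingTimes_nonempty (hs : s ∈ X) (hst : s ⊆ t) (hns : ∀ i ∈ s, n ≤ i) :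
    (hittingTimes X n t).Nonempty := by
  obtain ⟨k, hk⟩ := s.exists_nat_subset_range
  exact ⟨k, s, hs, fun i hi => Finset.mem_inter.2
    ⟨hst hi, Finset.mem_Ico.2 ⟨hns i hi, Finset.mem_range.1 (hk hi)⟩⟩⟩

lemma isLeast_hittingTimes_of_end_extension (hsub : t ⊆ t')
    (hlt : ∀ i ∈ t', i ∉ t → ∀ j ∈ t, j < i) (h : IsLeast (hittingTimes X n t) k) :
    IsLeast (hittingTimes X n t') k := by
  obtain ⟨⟨s, hs, hsk⟩, hmin⟩ := h
  refine ⟨⟨s, hs, hsk.trans (Finset.inter_subset_inter_right hsub)⟩, ?_⟩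
  rintro l ⟨s', hs', hsl⟩
  by_cases hst : s' ⊆ t
  · exact hmin ⟨s', hs', Finset.subset_inter hst (hsl.trans Finset.inter_subset_right)⟩
  · obtain ⟨i, his, hit⟩ := Finset.not_subset.1 hst
    -- The new element `i` of `s'` lies above all of `t`, so `s` has been completed before `l`.
    have hi := hsl his
    refine hmin ⟨s, hs, fun j hj => ?_⟩
    have hj := hsk hj
    simp only [Finset.mem_inter, Finset.mem_Ico] at hi hj ⊢
    exact ⟨hj.1, hj.2.1, (hlt i hi.1 hit j hj.1).trans hi.2.2⟩

end HittingTimes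

namespace MathiasForcing

variable {F : Filter ℕ} {p q : MathiasForcing F}

lemma le_iff_exists_stem_eq_union :
    p ≤ q ↔ p.side ⊆ q.side ∧ ∃ u : Finset ℕ, (u : Set ℕ) ⊆ q.side ∧ p.stem = q.stem ∪ u := by
  constructor
  · rintro ⟨hside, ⟨hsub, -⟩, hnew⟩
    refine ⟨hside, p.stem \ q.stem, fun i hi => ?_, (Finset.union_sdiff_of_subset hsub).symm⟩
    obtain ⟨hip, hiq⟩ := Finset.mem_sdiff.1 hi
    exact hnew i hip hiq
  · rintro ⟨hside, u, hu, hstem⟩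
    have hnew : ∀ i ∈ p.stem, i ∉ q.stem → i ∈ q.side := fun i hip hiq =>
      hu ((Finset.mem_union.1 (hstem ▸ hip)).resolve_left hiq)
    exact ⟨hside, ⟨hstem ▸ Finset.subset_union_left,
      fun i hip hiq j hj => q.stem_lt_side j hj i (hnew i hip hiq)⟩, hnew⟩

/-- The condition obtained from `p` by intersecting its side set with `A ∈ F`. -/
def restrict (p : MathiasForcing F) {A : Set ℕ} (hA : A ∈ F) : MathiasForcing F where
  stem := p.stem
  side := p.side ∩ A
  side_mem := inter_mem p.side_mem hA
  stem_lt_side i hi j hj := p.stem_lt_side i hi j hj.1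

lemma restrict_le (p : MathiasForcing F) {A : Set ℕ} (hA : A ∈ F) : p.restrict hA ≤ p :=
  le_iff_exists_stem_eq_union.2 ⟨inter_subset_left, ∅, by simp, by simp [restrict]⟩

lemma exists_le_stem_eq_union (hF : F ≤ atTop) (p : MathiasForcing F) {u : Finset ℕ}
    (hu : (u : Set ℕ) ⊆ p.side) : ∃ q ≤ p, q.stem = p.stem ∪ u := by
  have habove : {j | ∀ i ∈ u, i < j} ∈ F :=
    hF ((eventually_all_finset u).2 fun i _ => eventually_gt_atTop i)
  refine ⟨⟨p.stem ∪ u, p.side ∩ {j | ∀ i ∈ u, i < j}, inter_mem p.side_mem habove,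
    fun i hi j hj => ?_⟩, le_iff_exists_stem_eq_union.2 ⟨inter_subset_left, u, hu, rfl⟩, rfl⟩
  exact (Finset.mem_union.1 hi).elim (fun hip => p.stem_lt_side i hip j hj.1) (hj.2 i)

section NoDominatingReal

variable {τ : RelName (MathiasForcing F)} {n m : ℕ}

/-- Some condition with stem `t` forces `τ n = m`. -/
def StemForces (t : Finset ℕ) (τ : RelName (MathiasForcing F)) (n m : ℕ) : Prop :=
  ∃ r : MathiasForcing F, r.stem = t ∧ RelName.Forces r τ n m

lemma isFinsetPositive_stemForces (hτ : RelName.ForcesReal q τ) (n : ℕ) :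
    IsFinsetPositive F {u | ∃ m, StemForces (q.stem ∪ u) τ n m} := by
  intro A hA
  obtain ⟨r, hr, m, hm⟩ := hτ.1 n (q.restrict hA) (q.restrict_le hA)
  obtain ⟨-, u, hu, hstem⟩ := le_iff_exists_stem_eq_union.1 hr
  exact ⟨u, ⟨m, r, hstem, hm⟩, hu.trans inter_subset_right⟩

lemma StemForces.exists_le_forces {u : Finset ℕ} (h : StemForces (q.stem ∪ u) τ n m)
    (hu : (u : Set ℕ) ⊆ q.side) : ∃ r ≤ q, RelName.Forces r τ n m := by
  obtain ⟨r, hstem, hr⟩ := h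
  exact ⟨r.restrict q.side_mem, le_iff_exists_stem_eq_union.2 ⟨inter_subset_right, u, hu, hstem⟩,
    hr.mono (r.restrict_le q.side_mem)⟩

theorem addsNoDominatingReal_of_finsetMenger (h : FinsetMenger F) :
    AddsNoDominatingReal (MathiasForcing F) := by
  rintro p τ ⟨hreal, hdom⟩
  choose! g hg using fun (s : Finset ℕ)
    (hs : ∀ n, IsFinsetPositive F {u | ∃ m, StemForces (s ∪ u) τ n m}) => h.exists_bound hs
  obtain ⟨a, hga⟩ := exists_forall_eventuallyLE g
  obtain ⟨q, hqp, k, hk⟩ := hdom a p le_rfl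
  obtain ⟨l, hl⟩ := eventually_atTop.1 (hga q.stem)
  obtain ⟨u, ⟨n, hn, m, hm, hforce⟩, hu⟩ := hg q.stem
    (isFinsetPositive_stemForces (hreal.mono hqp)) (max k l) q.side q.side_mem
  obtain ⟨r, hrq, hr⟩ := hforce.exists_le_forces hu
  have ham : a n ≤ m := hk n ((le_max_left k l).trans hn) r hrq m hr
  exact (hm.trans_le ((hl n ((le_max_right k l).trans hn)).trans ham)).false

end NoDominatingReal

section HittingName

variable {X : ℕ → Set (Finset ℕ)} {n k : ℕ}

/-- The name of the function sending `n` to the least `k` such that the part of the generic set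
in `[n, k)` includes a member of `X n`. -/
def hittingName (F : Filter ℕ) (X : ℕ → Set (Finset ℕ)) : RelName (MathiasForcing F) :=
  {x | IsLeast (hittingTimes (X x.1) x.1 x.2.2.stem) x.2.1}

lemma isLeast_hittingTimes_stem_of_le {Y : Set (Finset ℕ)}
    (h : IsLeast (hittingTimes Y n q.stem) k) (hpq : p ≤ q) :
    IsLeast (hittingTimes Y n p.stem) k :=
  isLeast_hittingTimes_of_end_extension hpq.2.1.1 hpq.2.1.2 h

lemma forces_hittingName (h : IsLeast (hittingTimes (X n) n p.stem) k) :
    RelName.Forces p (hittingName F X) n k :=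
  fun q hq => ⟨q, le_rfl, p, hq, h⟩

lemma exists_le_isLeast_of_forces_hittingName (h : RelName.Forces p (hittingName F X) n k) :
    ∃ q ≤ p, IsLeast (hittingTimes (X n) n q.stem) k := by
  obtain ⟨q, hq, r, hqr, hr⟩ := h p le_rfl
  exact ⟨q, hq, isLeast_hittingTimes_stem_of_le hr hqr⟩

lemma forcesReal_hittingName (hF : F ≤ atTop) (hX : ∀ n, IsFinsetPositive F (X n))
    (p : MathiasForcing F) : RelName.ForcesReal p (hittingName F X) := by
  refine ⟨fun n q _ => ?_, fun n m m' q _ hm hm' => ?_⟩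
  · obtain ⟨s, hs, hsq⟩ := hX n (q.side ∩ Ici n) (inter_mem q.side_mem (hF (Ici_mem_atTop n)))
    obtain ⟨r, hr, hstem⟩ := q.exists_le_stem_eq_union hF (hsq.trans inter_subset_left)
    have hne : (hittingTimes (X n) n r.stem).Nonempty :=
      hittingTimes_nonempty hs (hstem ▸ Finset.subset_union_right) fun i hi => (hsq hi).2
    exact ⟨r, hr, _, forces_hittingName ⟨Nat.sInf_mem hne, fun _ => Nat.sInf_le⟩⟩
  · obtain ⟨r, hr, hleast⟩ := exists_le_isLeast_of_forces_hittingName hm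
    obtain ⟨r', hr', hleast'⟩ := exists_le_isLeast_of_forces_hittingName (hm'.mono hr)
    exact (isLeast_hittingTimes_stem_of_le hleast hr').unique hleast'

lemma forcesEventuallyGe_hittingName {a : ℕ → ℕ}
    (ha : ¬ IsFinsetPositive F (⋃ n, {s ∈ X n | s ⊆ Finset.range (a n)}))
    (p : MathiasForcing F) : RelName.ForcesEventuallyGe p (hittingName F X) a := by
  intro q _
  simp only [IsFinsetPositive, not_forall, not_exists, not_and] at ha
  obtain ⟨A, hA, hAX⟩ := ha
  obtain ⟨k, hk⟩ := q.stem.exists_nat_subset_range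
  refine ⟨q.restrict hA, q.restrict_le hA, k, fun n hn r hr m hm => ?_⟩
  obtain ⟨r', hr', ⟨s, hs, hsm⟩, -⟩ := exists_le_isLeast_of_forces_hittingName hm
  obtain ⟨-, u, hu, hstem⟩ := le_iff_exists_stem_eq_union.1 (hr'.trans hr)
  have hsA : (s : Set ℕ) ⊆ A := fun i hi => by
    obtain ⟨hir', him⟩ := Finset.mem_inter.1 (hsm hi)
    have hiq : i ∉ q.stem := fun hiq =>
      (hn.trans (Finset.mem_Ico.1 him).1).not_gt (Finset.mem_range.1 (hk hiq))
    exact (hu ((Finset.mem_union.1 (hstem ▸ hir')).resolve_left hiq)).2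
  by_contra! hma
  refine hAX s (mem_iUnion.2 ⟨n, hs, fun i hi => Finset.mem_range.2 ?_⟩) hsA
  exact (Finset.mem_Ico.1 (Finset.mem_inter.1 (hsm hi)).2).2.trans hma

theorem finsetMenger_of_addsNoDominatingReal (hF : F ≤ atTop)
    (h : AddsNoDominatingReal (MathiasForcing F)) : FinsetMenger F := by
  intro X hX
  by_contra! hno
  let p : MathiasForcing F := ⟨∅, univ, univ_mem, by simp⟩
  refine h p (hittingName F X) ⟨forcesReal_hittingName hF hX p, fun a =>
    forcesEventuallyGe_hittingName (hno _ fun n => ⟨sep_subset _ _, ?_⟩) p⟩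
  exact (Finset.finite_toSet (Finset.range (a n)).powerset).subset fun s hs =>
    Finset.mem_coe.2 (Finset.mem_powerset.2 hs.2)

end HittingName

theorem addsNoDominatingReal_iff (hF : F ≤ atTop) :
    AddsNoDominatingReal (MathiasForcing F) ↔ FinsetMenger F :=
  ⟨finsetMenger_of_addsNoDominatingReal hF, addsNoDominatingReal_of_finsetMenger⟩

end MathiasForcing

theorem theorem1p1 (F : Filter ℕ) (hF : F.NeBot) (hcof : F ≤ Filter.cofinite) :
    AddsNoDominatingReal (MathiasForcing F) ↔ MengerProperty (filterCantor F) :=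
  (MathiasForcing.addsNoDominatingReal_iff (hcof.trans_eq Nat.cofinite_eq_atTop)).trans
    mengerProperty_filterCantor_iff.symm
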